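/- Let $n\ge 3$ and let $\varphi:\mathbb S^{n-1}\times\mathbb R\to\mathbb C$ satisfy $\varphi(\theta,t)=\varphi(\theta,-t)=\varphi(-\theta,t)$ for all $(\theta,t)$; here $\varphi(\theta,t)$ is the value of $\varphi$ at the hyperplane $\{x\in\mathbb R^n: x\cdot\theta=t\}$. For $\omega\in\mathbb S^{n-1}$ let $d_*\theta$ be the normalized (probability) surface measure on the sphere $\mathbb S^{n-1}\cap\omega^\perp$, and let $$(R^*\varphi)(\omega,u)=\int_{\mathbb S^{n-1}\cap\omega^\perp}\varphi(\theta,\theta\cdot u)\,d_*\theta,\qquad u\in\omega^\perp,$$ be the dual Radon transform of $\varphi$ at the line $\mathbb R\omega+u$. Let $O(\omega^\perp)=\{\rho\in O(n):\rho\omega=\omega\}$ with its Haar probability measure $d\rho$. For a function $f(\omega,u)$, defined for $\omega\in\mathbb S^{n-1}$ and $u\in\omega^\perp$, let $$(\mathcal M_\omega f)(r)=\int_{O(\omega^\perp)} f(\omega,r\rho v)\,d\rho,\qquad r>0,$$ where $v\in\mathbb S^{n-1}\cap\omega^\perp$ is a fixed unit vector. Let $\sigma_{m}=2\pi^{(m+1)/2}/\Gamma((m+1)/2)$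 be the area of the $m$-dimensional unit sphere. Let $\omega\in\mathbb S^{n-1}$ and $r>0$ be such that the integral $$\int_0^r (r^2-t^2)^{(n-4)/2}\,dt\int_{\mathbb S^{n-1}\cap\omega^\perp}\varphi(\theta,t)\,d_*\theta$$ exists in the Lebesgue sense, that is, the function $(t,\theta)\mapsto (r^2-t^2)^{(n-4)/2}\varphi(\theta,t)$ is integrable on $(0,r)\times(\mathbb S^{n-1}\cap\omega^\perp)$ with respect to $dt\,d_*\theta$. Then, for every choice of $v$, the integral defining $(R^*\varphi)(\omega,r\rho v)$ converges absolutely for almost every $\rho\in O(\omega^\perp)$, the function $\rho\mapsto (R^*\varphi)(\omega,r\rho v)$ is integrable on $O(\omega^\perp)$, and $$(\mathcal M_\omega R^*\varphi)(r)=\frac{c}{r^{n-3}}\int_0^r (r^2-t^2)^{(n-4)/2}\,dt\int_{\mathbb S^{n-1}\cap\omega^\perp}\varphi(\theta,t)\,d_*\theta,\qquad c=\frac{2\,\sigma_{n-3}}{\sigma_{n-2}}.$$ -/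

import Mathlib

open MeasureTheory Set
open scoped InnerProductSpace

noncomputable section

namespace LineHyperplane

/-- Euclidean space of dimension `n`. -/
abbrev Eu (n : ℕ) : Type := EuclideanSpace ℝ (Fin n)

/-- The unit sphere of dimension `n - 1` in Euclidean space of dimension `n`. -/
abbrev Sph (n : ℕ) : Type := Metric.sphere (0 : Eu n) 1

/-- The hyperplane through the origin orthogonal to `ω`. -/
abbrev Perp {n : ℕ} (ω : Sph n) : Submodule ℝ (Eu n) := (ℝ ∙ (ω : Eu n))ᗮ

/-- The subsphere of the unit vectors orthogonal to `ω`: the unit sphere of `Perp ω`. -/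
abbrev SubSph {n : ℕ} (ω : Sph n) : Type := Metric.sphere (0 : Perp ω) 1

/-- A unit vector orthogonal to `ω`, seen as a point of the big unit sphere. -/
def SubSph.toSph {n : ℕ} {ω : Sph n} (θ : SubSph ω) : Sph n :=
  ⟨((θ : Perp ω) : Eu n), by
    have h : ‖(θ : Perp ω)‖ = 1 := norm_eq_of_mem_sphere θ
    exact mem_sphere_zero_iff_norm.2 h⟩

/-- The normalized surface measure on the unit vectors orthogonal to `ω`. It is the surface
measure of the unit sphere of `Perp ω` divided by its total mass. -/
def subSphMeasure {n : ℕ} (ω : Sph n) : Measure (SubSph ω) :=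
  ((volume : Measure (Perp ω)).toSphere univ)⁻¹ • (volume : Measure (Perp ω)).toSphere

/-- The area `2 π ^ ((m + 1) / 2) / Γ ((m + 1) / 2)` of the unit sphere of dimension `m`
(in Euclidean space of dimension `m + 1`). -/
def sphereArea (m : ℕ) : ℝ :=
  2 * Real.pi ^ (((m : ℝ) + 1) / 2) / Real.Gamma (((m : ℝ) + 1) / 2)

/-- The manifold of pairs `(ω, u)`, where `ω` is a unit vector and `u` is orthogonal to `ω`.
The pair `(ω, u)` represents the line through `u` in the direction of `ω`. -/
abbrev LinePar (n : ℕ) : Type := (ω : Sph n) × Perp ω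

/-- The dual Radon transform of a function `φ` of hyperplanes, where `φ θ t` is the value at the
hyperplane `{x | ⟪x, θ⟫ = t}`: the average of `φ` over the hyperplanes that contain the line. -/
def dualRadon {n : ℕ} (φ : Sph n → ℝ → ℂ) (ℓ : LinePar n) : ℂ :=
  ∫ θ : SubSph ℓ.1, φ θ.toSph ⟪(θ : Perp ℓ.1), ℓ.2⟫_ℝ ∂(subSphMeasure ℓ.1)

/-- The orthogonal group `O(n)`, as the group of the continuous linear maps `T` of Euclidean space
such that `T` composed with its adjoint, in either order, is the identity; its topology is that of
the operator norm. -/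
abbrev OrthGroup (n : ℕ) : Type := unitary (Eu n →L[ℝ] Eu n)

instance instContinuousStarEnd (n : ℕ) : ContinuousStar (Eu n →L[ℝ] Eu n) :=
  ⟨(ContinuousLinearMap.adjoint (𝕜 := ℝ) (E := Eu n) (F := Eu n)).continuous⟩

/-- The stationary subgroup of `ω` in the orthogonal group. -/
def orthStab {n : ℕ} (ω : Sph n) : Subgroup (OrthGroup n) where
  carrier := {ρ | (ρ : Eu n →L[ℝ] Eu n) (ω : Eu n) = ω}
  one_mem' := by simp
  mul_mem' := by
    intro a b ha hb
    simp only [mem_ofPred_eq] at ha hb ⊢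
    simp [ha, hb]
  inv_mem' := by
    intro a ha
    simp only [mem_ofPred_eq] at ha ⊢
    have h : ((a⁻¹ * a : OrthGroup n) : Eu n →L[ℝ] Eu n) (ω : Eu n) = ω := by simp
    simpa only [Submonoid.coe_mul, mul_apply_eq_comp, ha] using h

theorem mem_orthStab {n : ℕ} {ω : Sph n} {ρ : OrthGroup n} :
    ρ ∈ orthStab ω ↔ (ρ : Eu n →L[ℝ] Eu n) (ω : Eu n) = ω := Iff.rfl

theorem inner_orth_apply {n : ℕ} (ρ : OrthGroup n) (x y : Eu n) :
    ⟪(ρ : Eu n →L[ℝ] Eu n) x, (ρ : Eu n →L[ℝ] Eu n) y⟫_ℝ = ⟪x, y⟫_ℝ :=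
  Unitary.inner_map_map ρ x y

/-- The natural action of the stationary subgroup of `ω` on `Perp ω`. -/
def stabAct {n : ℕ} {ω : Sph n} (ρ : orthStab ω) (u : Perp ω) : Perp ω :=
  ⟨((ρ : OrthGroup n) : Eu n →L[ℝ] Eu n) (u : Eu n), by
    rw [Submodule.mem_orthogonal_singleton_iff_inner_right]
    have h := inner_orth_apply (ρ : OrthGroup n) (ω : Eu n) (u : Eu n)
    rw [mem_orthStab.1 ρ.2] at h
    rw [h]
    exact Submodule.mem_orthogonal_singleton_iff_inner_right.1 u.2⟩

theorem isCompact_orthGroup (n : ℕ) :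
    IsCompact ((unitary (Eu n →L[ℝ] Eu n) : Submonoid (Eu n →L[ℝ] Eu n)) :
      Set (Eu n →L[ℝ] Eu n)) := by
  have : ProperSpace (Eu n →L[ℝ] Eu n) := FiniteDimensional.proper ℝ _
  refine (isCompact_closedBall (0 : Eu n →L[ℝ] Eu n) 1).of_isClosed_subset
    isClosed_unitary ?_
  intro T hT
  rw [mem_closedBall_zero_iff]
  refine T.opNorm_le_bound zero_le_one fun x => ?_
  rw [one_mul, ContinuousLinearMap.norm_map_of_mem_unitary hT x]

theorem isClosed_orthStab {n : ℕ} (ω : Sph n) : IsClosed (orthStab ω : Set (OrthGroup n)) := by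
  have hc : Continuous fun ρ : OrthGroup n => (ρ : Eu n →L[ℝ] Eu n) (ω : Eu n) :=
    (ContinuousLinearMap.apply ℝ (Eu n) (ω : Eu n)).continuous.comp continuous_subtype_val
  exact isClosed_eq hc continuous_const

instance orthStab.instCompactSpace {n : ℕ} (ω : Sph n) : CompactSpace (orthStab ω) := by
  have : CompactSpace (OrthGroup n) := isCompact_iff_compactSpace.1 (isCompact_orthGroup n)
  exact isCompact_iff_compactSpace.1 (isClosed_orthStab ω).isCompact

/-- The Haar probability measure on the stationary subgroup of `ω`. -/
def orthStabHaar {n : ℕ} (ω : Sph n) : Measure (orthStab ω) :=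
  Measure.haarMeasure (⊤ : TopologicalSpace.PositiveCompacts (orthStab ω))

/-- The mean value operator, which averages a function of lines over the cluster of the lines in
the direction of `ω` at distance `r` from the origin. Here `v` is a unit vector orthogonal
to `ω`, the base point of the cluster. -/
def clusterMean {n : ℕ} (ω : Sph n) (v : SubSph ω) (f : LinePar n → ℂ) (r : ℝ) : ℂ :=
  ∫ ρ : orthStab ω, f ⟨ω, r • stabAct ρ (v : Perp ω)⟩ ∂(orthStabHaar ω)

/-- The symmetry of an even function of hyperplanes. -/
def IsEvenHyp {n : ℕ} (φ : Sph n → ℝ → ℂ) : Prop :=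
  ∀ (θ : Sph n) (t : ℝ), φ θ t = φ θ (-t) ∧ φ θ (-t) = φ (-θ) t

end LineHyperplane

end

open LineHyperplane

open scoped ENNReal
open Module (finrank)

/-! ### Polar coordinates and orthogonal splitting. -/

section Sphere

variable {E : Type*} [NormedAddCommGroup E] [MeasurableSpace E] [BorelSpace E]

/-! The left-hand side is the double average of `φ θ (r * ⟪θ, ρv⟫)` over `ρ` and `θ`. By evenness
only the height `r * |⟪θ, ρv⟫|` matters. For Haar-random `ρ` the vector `ρv` is uniform on the unit
sphere of `Perp ω` (`measurePreserving_stabSphere`), so for fixed `θ` the law of the height does not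
depend on `θ` (`map_abs_inner_subSphMeasure`). Height and direction are therefore independent: the
map `(ρ, θ) ↦ (height, θ)` carries Haar times surface measure to a product measure
(`measurePreserving_direction_height`). Pulling back along this map gives the integrability claims,
and Fubini on both sides gives the formula.

The constant and the kernel are the density of the height, found in `lintegral_toSphere_abs_inner`:
a function of `⟪v, x⟫ / ‖x‖` times a radial cutoff is integrated over the space, once in polar
coordinates and once along the splitting into `ℝ v` and its complement. The radial factors cancel,
leaving `sin α ^ k dα` with `t = r |cos α|` and `k = n - 3`. -/

theorem lintegral_eq_lintegral_toSphere [NormedSpace ℝ E] [FiniteDimensional ℝ E] [Nontrivial E]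
    (μ : Measure E) [μ.IsAddHaarMeasure] {f : E → ℝ≥0∞} (hf : Measurable f) :
    ∫⁻ x, f x ∂μ = ∫⁻ θ, ∫⁻ s in Ioi (0 : ℝ),
      ENNReal.ofReal (s ^ (finrank ℝ E - 1)) * f (s • (θ : E)) ∂volume ∂μ.toSphere := by
  have h0 : MeasurableSet ({0}ᶜ : Set E) := (measurableSet_singleton _).compl
  have hmp := μ.measurePreserving_homeomorphUnitSphereProd
  calc
    ∫⁻ x, f x ∂μ = ∫⁻ x : ({0}ᶜ : Set E), f x ∂(μ.comap (↑)) := by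
      rw [lintegral_subtype_comap h0 f, restrict_compl_singleton]
    _ = ∫⁻ p, f (p.2.1 • p.1.1)
          ∂(μ.toSphere.prod (Measure.volumeIoiPow (finrank ℝ E - 1))) := by
      rw [← hmp.lintegral_comp (by fun_prop)]
      refine lintegral_congr fun x => ?_
      congr 1
      have hx : ‖(x : E)‖ ≠ 0 := norm_ne_zero_iff.2 x.2
      simp [smul_smul, hx]
    _ = _ := by
      rw [lintegral_prod _ (by fun_prop)]
      refine lintegral_congr fun θ => ?_
      rw [Measure.volumeIoiPow, lintegral_withDensity_eq_lintegral_mul _ (by fun_prop)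
        (by fun_prop), ← lintegral_subtype_comap measurableSet_Ioi]
      rfl

theorem lintegral_comp_norm [NormedSpace ℝ E] [FiniteDimensional ℝ E] [Nontrivial E]
    (μ : Measure E) [μ.IsAddHaarMeasure] {f : ℝ → ℝ≥0∞} (hf : Measurable f) :
    ∫⁻ x, f ‖x‖ ∂μ = μ.toSphere univ * ∫⁻ s in Ioi (0 : ℝ),
      ENNReal.ofReal (s ^ (finrank ℝ E - 1)) * f s := by
  rw [lintegral_eq_lintegral_toSphere μ (f := fun x => f ‖x‖) (by fun_prop), mul_comm,
    ← lintegral_const]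
  refine lintegral_congr fun θ => setLIntegral_congr_fun measurableSet_Ioi fun s hs => ?_
  have hs' : (0 : ℝ) < s := hs
  simp [norm_smul, abs_of_pos hs']

/-- The orthogonal decomposition along `v` is an isometry, hence preserves volume, and Pythagoras
recovers the norm from the two components. -/
theorem lintegral_inner_norm [InnerProductSpace ℝ E] [FiniteDimensional ℝ E]
    {v : E} (hv : ‖v‖ = 1) {f : ℝ → ℝ → ℝ≥0∞} (hf : Measurable fun p : ℝ × ℝ => f p.1 p.2) :
    ∫⁻ x : E, f ⟪v, x⟫_ℝ ‖x‖ =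
      ∫⁻ a : ℝ, ∫⁻ y : (ℝ ∙ v)ᗮ, f a √(a ^ 2 + ‖y‖ ^ 2) := by
  set K : Submodule ℝ E := ℝ ∙ v
  let e := LinearIsometryEquiv.toSpanUnitSingleton (𝕜 := ℝ) v hv
  have hm1 : MeasurePreserving (fun x : E => WithLp.ofLp (K.orthogonalDecomposition x)) :=
    (WithLp.volume_preserving_ofLp (U := K) (V := Kᗮ)).comp
      K.orthogonalDecomposition.measurePreserving
  have hm2 : MeasurePreserving (Prod.map e id : ℝ × Kᗮ → K × Kᗮ) :=
    e.measurePreserving.prod (MeasurePreserving.id volume)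
  have hF : Measurable fun p : K × Kᗮ => f ⟪v, (p.1 : E)⟫_ℝ √(‖p.1‖ ^ 2 + ‖p.2‖ ^ 2) := by
    have : Measurable fun p : K × Kᗮ => (⟪v, (p.1 : E)⟫_ℝ, √(‖p.1‖ ^ 2 + ‖p.2‖ ^ 2)) := by
      fun_prop
    exact hf.comp this
  calc
    _ = ∫⁻ x : E, (fun p : K × Kᗮ => f ⟪v, (p.1 : E)⟫_ℝ √(‖p.1‖ ^ 2 + ‖p.2‖ ^ 2))
          (WithLp.ofLp (K.orthogonalDecomposition x)) := by
      refine lintegral_congr fun x => ?_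
      have h1 : ‖x‖ = √(‖(K.orthogonalDecomposition x).fst‖ ^ 2
          + ‖(K.orthogonalDecomposition x).snd‖ ^ 2) := by
        rw [← WithLp.prod_norm_eq_of_L2, LinearIsometryEquiv.norm_map]
      have h2 : ⟪v, x⟫_ℝ = ⟪v, ((K.orthogonalDecomposition x).fst : E)⟫_ℝ := by
        have hvK : v ∈ K := Submodule.mem_span_singleton_self v
        rw [Submodule.orthogonalDecomposition_apply]
        change ⟪v, x⟫_ℝ = ⟪v, K.starProjection x⟫_ℝ
        rw [← K.inner_starProjection_left_eq_right, Submodule.starProjection_eq_self_iff.2 hvK]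
      rw [h1, h2]
      rfl
    _ = ∫⁻ p : ℝ × Kᗮ, f p.1 √(p.1 ^ 2 + ‖p.2‖ ^ 2) := by
      rw [hm1.lintegral_comp hF, ← hm2.lintegral_comp hF]
      refine lintegral_congr fun p => ?_
      have h1 : ((e p.1 : K) : E) = p.1 • v := rfl
      have h2 : ‖e p.1‖ = ‖p.1‖ := e.norm_map p.1
      simp [h1, h2, inner_smul_right, hv]
    _ = _ := by
      rw [Measure.volume_eq_prod, lintegral_prod]
      have : Measurable fun p : ℝ × Kᗮ => (p.1, √(p.1 ^ 2 + ‖p.2‖ ^ 2)) := by fun_prop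
      exact (hf.comp this).aemeasurable

end Sphere

/-- Under `t = r |cos α|` one has `r ^ 2 - t ^ 2 = (r sin α) ^ 2` and `|dt| = r sin α dα`, which
lowers the power of the sine by one. The two halves of `(0, π)` contribute equally, whence the
factor 2. -/
theorem lintegral_comp_cos {r : ℝ} (hr : 0 < r) (k : ℕ) {h : ℝ → ℝ≥0∞} :
    ∫⁻ α in Ioo 0 Real.pi, ENNReal.ofReal (Real.sin α ^ k) * h (r * |Real.cos α|) =
      2 * ∫⁻ t in Ioo 0 r,
        ENNReal.ofReal ((r ^ k)⁻¹ * (r ^ 2 - t ^ 2) ^ (((k : ℝ) - 1) / 2)) * h t := by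
  have hpi := Real.pi_pos
  -- Here `s` is one of the two halves and `ε = ±1` is the sign of the cosine on it, so that `|cos
  -- α| = ε * cos α` is injective there.
  have key : ∀ (s : Set ℝ) (ε : ℝ), MeasurableSet s → ε ^ 2 = 1 → s ⊆ Ioo 0 Real.pi →
      (∀ α ∈ s, 0 < ε * Real.cos α) → (∀ t ∈ Ioo 0 1, ∃ α ∈ s, ε * Real.cos α = t) →
      ∫⁻ α in s, ENNReal.ofReal (Real.sin α ^ k) * h (r * |Real.cos α|) =
      ∫⁻ t in Ioo 0 r,
        ENNReal.ofReal ((r ^ k)⁻¹ * (r ^ 2 - t ^ 2) ^ (((k : ℝ) - 1) / 2)) * h t := by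
    intro s ε hs hε hsub hpos hsurj
    have hε1 : |ε| = 1 := by rwa [← sq_eq_sq₀ (abs_nonneg _) zero_le_one, sq_abs, one_pow]
    have hε0 : ε ≠ 0 := by rintro rfl; simp at hε
    have himg : (fun α => r * (ε * Real.cos α)) '' s = Ioo 0 r := by
      ext t
      constructor
      · rintro ⟨α, hα, rfl⟩
        refine ⟨mul_pos hr (hpos α hα), ?_⟩
        have hsin := Real.sin_pos_of_mem_Ioo (hsub hα)
        have : ε * Real.cos α < 1 := by
          nlinarith [Real.sin_sq_add_cos_sq α, hpos α hα, mul_pow ε (Real.cos α) 2, sq_pos_of_pos hsin]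
        nlinarith
      · rintro ⟨h1, h2⟩
        obtain ⟨α, hα, h⟩ := hsurj (t / r) ⟨by positivity, (div_lt_one hr).2 h2⟩
        exact ⟨α, hα, by simp only [h]; field_simp⟩
    have hinj : InjOn (fun α => r * (ε * Real.cos α)) s := by
      intro a ha b hb hab
      have := mul_left_cancel₀ hε0 (mul_left_cancel₀ hr.ne' hab)
      exact Real.injOn_cos (Ioo_subset_Icc_self (hsub ha)) (Ioo_subset_Icc_self (hsub hb)) this
    rw [← himg, lintegral_image_eq_lintegral_abs_deriv_mul hs
      (f' := fun α => r * (ε * (-Real.sin α))) (fun α _ =>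
        (((Real.hasDerivAt_cos α).const_mul ε).const_mul r).hasDerivWithinAt) hinj]
    refine setLIntegral_congr_fun hs fun α hα => ?_
    have hsin := Real.sin_pos_of_mem_Ioo (hsub hα)
    have hcos : ε * Real.cos α = |Real.cos α| := by
      rw [← abs_of_pos (hpos α hα), abs_mul, hε1, one_mul]
    rw [← mul_assoc, hcos, ← ENNReal.ofReal_mul (abs_nonneg _)]
    congr 2
    have e1 : |r * (ε * -Real.sin α)| = r * Real.sin α := by
      rw [abs_mul, abs_mul, hε1, abs_neg, abs_of_pos hr, abs_of_pos hsin, one_mul]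
    have e2 : r ^ 2 - (r * |Real.cos α|) ^ 2 = (r * Real.sin α) ^ 2 := by
      rw [mul_pow, sq_abs, Real.cos_sq']; ring
    have hrs : 0 < r * Real.sin α := mul_pos hr hsin
    rw [e1, e2, ← Real.rpow_natCast (r * Real.sin α) 2, ← Real.rpow_mul hrs.le]
    have : ((2 : ℕ) : ℝ) * (((k : ℝ) - 1) / 2) = k - 1 := by push_cast; ring
    rw [this, Real.rpow_sub_one hrs.ne', Real.rpow_natCast, mul_pow]
    field_simp
  have hsplit : (Ioo 0 (Real.pi / 2) ∪ Ioo (Real.pi / 2) Real.pi : Set ℝ)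
      =ᵐ[volume] Ioo 0 Real.pi := by
    rw [← Ioo_union_Ico_eq_Ioo (show 0 < Real.pi / 2 by positivity)
      (show Real.pi / 2 ≤ Real.pi by linarith)]
    exact (ae_eq_refl _).union Ioo_ae_eq_Ico
  rw [← setLIntegral_congr hsplit, lintegral_union measurableSet_Ioo, two_mul]
  · congr 1
    · refine key _ 1 measurableSet_Ioo (by norm_num) (Ioo_subset_Ioo_right (by linarith))
        (fun α hα => ?_) fun t ht => ⟨Real.arccos t, ⟨?_, ?_⟩, ?_⟩
      · rw [one_mul]
        exact Real.cos_pos_of_mem_Ioo ⟨by linarith [hα.1], hα.2⟩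
      · exact Real.arccos_pos.2 ht.2
      · exact Real.arccos_lt_pi_div_two.2 ht.1
      · rw [one_mul, Real.cos_arccos (by linarith [ht.1]) ht.2.le]
    · refine key _ (-1) measurableSet_Ioo (by norm_num) (Ioo_subset_Ioo_left (by linarith))
        (fun α hα => ?_) fun t ht => ⟨Real.pi - Real.arccos t, ⟨?_, ?_⟩, ?_⟩
      · have := Real.cos_neg_of_pi_div_two_lt_of_lt hα.1 (by linarith [hα.2])
        linarith
      · linarith [Real.arccos_lt_pi_div_two.2 ht.1]
      · linarith [Real.arccos_pos.2 ht.2]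
      · rw [Real.cos_pi_sub, Real.cos_arccos (by linarith [ht.1]) ht.2.le]; ring
  · exact Set.disjoint_left.2 fun x hx hx' => by linarith [hx.2, hx'.1]

/-! ### The law of one coordinate on the sphere. -/

section Slice

variable {E : Type*} [NormedAddCommGroup E] [MeasurableSpace E] [BorelSpace E]
  [InnerProductSpace ℝ E] [FiniteDimensional ℝ E]

/-- Polar coordinates in the half-plane `b > 0` separate the variables: `b ^ k` and the Jacobian `s`
give `s ^ (k + 1) * sin α ^ k`. -/
theorem lintegral_polar_abs_cos {r : ℝ} (k : ℕ) {h g : ℝ → ℝ≥0∞} (hh : Measurable h)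
    (hg : Measurable g) :
    ∫⁻ a : ℝ, ∫⁻ b in Ioi (0 : ℝ), ENNReal.ofReal (b ^ k) *
        (h (r * (|a| / √(a ^ 2 + b ^ 2))) * g √(a ^ 2 + b ^ 2)) =
      (∫⁻ s in Ioi (0 : ℝ), ENNReal.ofReal (s ^ (k + 1)) * g s) *
        ∫⁻ α in Ioo 0 Real.pi, ENNReal.ofReal (Real.sin α ^ k) * h (r * |Real.cos α|) := by
  have hpi := Real.pi_pos
  -- Extension by zero to `b ≤ 0`, since `polarCoord` uses all angles in `(-π, π)`.
  set F : ℝ × ℝ → ℝ≥0∞ := {p : ℝ × ℝ | 0 < p.2}.indicator fun p => ENNReal.ofReal (p.2 ^ k) *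
    (h (r * (|p.1| / √(p.1 ^ 2 + p.2 ^ 2))) * g √(p.1 ^ 2 + p.2 ^ 2)) with hF
  have hFm : Measurable F :=
    Measurable.indicator (by fun_prop) (measurableSet_lt measurable_const measurable_snd)
  have h1 : ∫⁻ a : ℝ, ∫⁻ b in Ioi (0 : ℝ), ENNReal.ofReal (b ^ k) *
        (h (r * (|a| / √(a ^ 2 + b ^ 2))) * g √(a ^ 2 + b ^ 2)) = ∫⁻ p, F p := by
    rw [Measure.volume_eq_prod, lintegral_prod _ hFm.aemeasurable]
    refine lintegral_congr fun a => ?_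
    rw [← lintegral_indicator measurableSet_Ioi]
    rfl
  have h2 : ∀ p ∈ polarCoord.target, ENNReal.ofReal p.1 • F (polarCoord.symm p) =
      (ENNReal.ofReal (p.1 ^ (k + 1)) * g p.1) * (Ioo 0 Real.pi).indicator
        (fun α => ENNReal.ofReal (Real.sin α ^ k) * h (r * |Real.cos α|)) p.2 := by
    rintro ⟨s, α⟩ hp
    rw [polarCoord_target] at hp
    obtain ⟨hs, hα⟩ := hp
    replace hs : 0 < s := hs
    have hsq : √((s * Real.cos α) ^ 2 + (s * Real.sin α) ^ 2) = s := by
      rw [mul_pow, mul_pow, ← mul_add, Real.cos_sq_add_sin_sq, mul_one, Real.sqrt_sq hs.le]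
    rw [polarCoord_symm_apply]
    by_cases hα0 : 0 < α
    · have hsin : 0 < Real.sin α := Real.sin_pos_of_mem_Ioo ⟨hα0, hα.2⟩
      rw [indicator_of_mem (show α ∈ Ioo 0 Real.pi from ⟨hα0, hα.2⟩), hF,
        indicator_of_mem (show (s * Real.cos α, s * Real.sin α) ∈ {p : ℝ × ℝ | 0 < p.2} from
          mul_pos hs hsin)]
      simp only [hsq]
      rw [abs_mul, abs_of_pos hs, mul_div_cancel_left₀ _ hs.ne', mul_pow, pow_succ,
        ENNReal.ofReal_mul (by positivity), ENNReal.ofReal_mul (by positivity), smul_eq_mul]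
      ring
    · have hsin : ¬ 0 < s * Real.sin α := by
        have : Real.sin α ≤ 0 :=
          Real.sin_nonpos_of_nonpos_of_neg_pi_le (not_lt.1 hα0) hα.1.le
        nlinarith
      rw [indicator_of_notMem (fun hh => hα0 hh.1), hF,
        indicator_of_notMem (show (s * Real.cos α, s * Real.sin α) ∉ {p : ℝ × ℝ | 0 < p.2} from hsin)]
      simp
  rw [h1, ← lintegral_comp_polarCoord_symm, setLIntegral_congr_fun
    polarCoord.open_target.measurableSet h2, polarCoord_target, Measure.volume_eq_prod,
    ← Measure.prod_restrict, lintegral_prod_mul (f := fun s => ENNReal.ofReal (s ^ (k + 1)) * g s)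
      (g := (Ioo 0 Real.pi).indicator fun α =>
        ENNReal.ofReal (Real.sin α ^ k) * h (r * |Real.cos α|)) (by fun_prop)
      (Measurable.aemeasurable (Measurable.indicator (by fun_prop) measurableSet_Ioo)),
    setLIntegral_indicator measurableSet_Ioo,
    inter_eq_left.2 (Ioo_subset_Ioo_left (by linarith))]

/-- The law of `r * |⟪v, θ⟫|` under the surface measure of the unit sphere. -/
theorem lintegral_toSphere_abs_inner {k : ℕ} (hE : finrank ℝ E = k + 2) {v : E} (hv : ‖v‖ = 1)
    {r : ℝ} (hr : 0 < r) {h : ℝ → ℝ≥0∞} (hh : Measurable h) :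
    ∫⁻ θ : Metric.sphere (0 : E) 1, h (r * |⟪v, (θ : E)⟫_ℝ|) ∂(volume : Measure E).toSphere =
      (volume : Measure (ℝ ∙ v)ᗮ).toSphere univ * (2 * ∫⁻ t in Ioo 0 r,
        ENNReal.ofReal ((r ^ k)⁻¹ * (r ^ 2 - t ^ 2) ^ (((k : ℝ) - 1) / 2)) * h t) := by
  have hEn : Nontrivial E := Module.nontrivial_of_finrank_pos (R := ℝ) (by omega)
  have hv0 : v ≠ 0 := by rintro rfl; simp at hv
  have hFd : finrank ℝ (ℝ ∙ v)ᗮ = k + 1 := by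
    have : Fact (finrank ℝ E = (k + 1) + 1) := ⟨hE⟩
    exact Submodule.finrank_orthogonal_span_singleton hv0
  have hFn : Nontrivial (ℝ ∙ v)ᗮ := Module.nontrivial_of_finrank_pos (R := ℝ) (by omega)
  -- A radial cutoff that makes the common factor `A` finite and nonzero, so that it can be
  -- cancelled; both facts are read off the volume of the unit ball.
  set g : ℝ → ℝ≥0∞ := (Iio 1).indicator 1 with hg
  have hgm : Measurable g := measurable_one.indicator measurableSet_Iio
  set A : ℝ≥0∞ := ∫⁻ s in Ioi (0 : ℝ), ENNReal.ofReal (s ^ (k + 1)) * g s with hA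
  have hball : volume (Metric.ball (0 : E) 1) = (volume : Measure E).toSphere univ * A := by
    have h1 := lintegral_comp_norm (volume : Measure E) hgm
    rw [hE] at h1
    rw [hA, show k + 1 = k + 2 - 1 from rfl, ← h1, ← lintegral_indicator_one measurableSet_ball]
    refine lintegral_congr fun x => ?_
    simp [hg, indicator]
  have hA0 : A ≠ 0 := by
    intro h0
    rw [h0, mul_zero] at hball
    exact (Metric.measure_ball_pos volume (0 : E) one_pos).ne' hball
  have hAtop : A ≠ ⊤ := by
    intro h0
    rw [h0, ENNReal.mul_top] at hball
    · exact (measure_ball_lt_top (μ := volume) (x := (0 : E)) (r := 1)).ne hball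
    · exact Measure.measure_univ_ne_zero.2 (volume : Measure E).toSphere_ne_zero
  set f : ℝ → ℝ → ℝ≥0∞ := fun a s => h (r * (|a| / s)) * g s with hf
  have hfm : Measurable fun p : ℝ × ℝ => f p.1 p.2 := by
    simp only [hf]; fun_prop
  have h1 : ∫⁻ x : E, f ⟪v, x⟫_ℝ ‖x‖ = (∫⁻ θ : Metric.sphere (0 : E) 1,
      h (r * |⟪v, (θ : E)⟫_ℝ|) ∂(volume : Measure E).toSphere) * A := by
    have hm : Measurable fun x : E => f ⟪v, x⟫_ℝ ‖x‖ := by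
      have : Measurable fun x : E => (⟪v, x⟫_ℝ, ‖x‖) := by fun_prop
      exact hfm.comp this
    rw [lintegral_eq_lintegral_toSphere volume hm, ← lintegral_mul_const _ (by fun_prop)]
    refine lintegral_congr fun θ => ?_
    rw [← lintegral_const_mul _ (by fun_prop), hE]
    refine setLIntegral_congr_fun measurableSet_Ioi fun s hs => ?_
    replace hs : 0 < s := hs
    have hn : ‖s • (θ : E)‖ = s := by simp [norm_smul, abs_of_pos hs]
    simp only [hf]
    rw [hn, inner_smul_right, abs_mul, abs_of_pos hs, mul_div_cancel_left₀ _ hs.ne']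
    change ENNReal.ofReal (s ^ (k + 1)) * _ = _
    ring
  have h2 : ∫⁻ x : E, f ⟪v, x⟫_ℝ ‖x‖ = (volume : Measure (ℝ ∙ v)ᗮ).toSphere univ *
      (A * ∫⁻ α in Ioo 0 Real.pi, ENNReal.ofReal (Real.sin α ^ k) * h (r * |Real.cos α|)) := by
    rw [lintegral_inner_norm hv hfm, ← lintegral_polar_abs_cos k hh hgm, ← lintegral_const_mul']
    · refine lintegral_congr fun a => ?_
      have := lintegral_comp_norm (volume : Measure (ℝ ∙ v)ᗮ)
        (f := fun s => f a √(a ^ 2 + s ^ 2)) (by simp only [hf]; fun_prop)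
      rw [hFd] at this
      exact this
    · exact measure_ne_top _ _
  rw [← lintegral_comp_cos hr k, ← ENNReal.mul_left_inj hA0 hAtop, ← h1, h2]
  ring

theorem toSphere_univ_eq_sphereArea {m : ℕ} (hE : finrank ℝ E = m + 1) :
    (volume : Measure E).toSphere univ = ENNReal.ofReal (sphereArea m) := by
  have hEn : Nontrivial E := Module.nontrivial_of_finrank_pos (R := ℝ) (by omega)
  have hpi := Real.pi_pos
  rw [Measure.toSphere_apply_univ, InnerProductSpace.volume_ball, hE, ENNReal.ofReal_one, one_pow,
    one_mul, ← ENNReal.ofReal_natCast, ← ENNReal.ofReal_mul (by positivity)]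
  congr 1
  have hx : (0 : ℝ) < ((m : ℝ) + 1) / 2 := by positivity
  have h1 : √Real.pi ^ (m + 1) = Real.pi ^ (((m : ℝ) + 1) / 2) := by
    rw [Real.sqrt_eq_rpow, ← Real.rpow_natCast, ← Real.rpow_mul hpi.le]
    congr 1; push_cast; ring
  rw [h1]
  push_cast
  rw [Real.Gamma_add_one hx.ne', sphereArea]
  have := Real.Gamma_pos_of_pos hx
  field_simp

end Slice

/-! ### Invariance of the surface measure under isometries. -/

section Invariance

variable {E : Type*} [NormedAddCommGroup E] [MeasurableSpace E] [BorelSpace E]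
  [InnerProductSpace ℝ E] [FiniteDimensional ℝ E]

/-- The action of a linear isometry on the unit sphere. -/
def sphereMap (e : E ≃ₗᵢ[ℝ] E) (θ : Metric.sphere (0 : E) 1) : Metric.sphere (0 : E) 1 :=
  ⟨e θ, by simp⟩

open scoped Pointwise in
-- The surface measure of `s` is the dimension times the volume of the cone over `s`, and a linear
-- isometry maps cones to cones and preserves volume.
theorem measurePreserving_sphereMap (e : E ≃ₗᵢ[ℝ] E) :
    MeasurePreserving (sphereMap e) (volume : Measure E).toSphere
      (volume : Measure E).toSphere := by
  have hm : Measurable (sphereMap e) := by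
    unfold sphereMap
    exact Measurable.subtype_mk (by fun_prop)
  refine ⟨hm, Measure.ext fun s hs => ?_⟩
  rw [Measure.map_apply hm hs, Measure.toSphere_apply' _ hs, Measure.toSphere_apply' _ (hm hs),
    ← e.measurePreserving.measure_preimage_emb e.toMeasurableEquiv.measurableEmbedding
      (Ioo (0 : ℝ) 1 • (Subtype.val '' s))]
  congr 2
  ext x
  simp only [mem_smul, mem_preimage, mem_image, Subtype.exists, exists_and_right, exists_eq_right]
  constructor
  · rintro ⟨c, hc, y, ⟨hy, hys⟩, rfl⟩
    exact ⟨c, hc, e y, ⟨by simpa using hy, hys⟩, by simp⟩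
  · rintro ⟨c, hc, y, ⟨hy, hys⟩, hxy⟩
    exact ⟨c, hc, e.symm y, ⟨by simpa using hy, by simpa [sphereMap] using hys⟩,
      e.injective (by simpa using hxy)⟩

end Invariance

/-! ### Haar measure on the stationary subgroup and its orbits. -/

namespace LineHyperplane

variable {n : ℕ} {ω : Sph n}

instance instIsProbabilityMeasureOrthStabHaar (ω : Sph n) :
    IsProbabilityMeasure (orthStabHaar ω) :=
  ⟨Measure.haarMeasure_self⟩

instance instIsHaarMeasureOrthStabHaar (ω : Sph n) : (orthStabHaar ω).IsHaarMeasure := by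
  unfold orthStabHaar; infer_instance

/-- A right translate of the Haar measure is again left invariant, so by uniqueness on a compact
group it is a multiple of it; total mass 1 forces the factor to be 1. -/
instance instIsMulRightInvariantOrthStabHaar (ω : Sph n) :
    (orthStabHaar ω).IsMulRightInvariant := by
  refine ⟨fun g => ?_⟩
  have h1 : IsProbabilityMeasure ((orthStabHaar ω).map (· * g)) :=
    Measure.isProbabilityMeasure_map (by fun_prop)
  have h2 := Measure.isMulInvariant_eq_smul_of_compactSpace
    ((orthStabHaar ω).map (· * g)) (orthStabHaar ω)
  have h3 := congrArg (fun m => m univ) h2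
  simp only [measure_univ, Measure.smul_apply] at h3
  rw [h2]
  have : Measure.haarScalarFactor ((orthStabHaar ω).map (· * g)) (orthStabHaar ω) = 1 := by
    have := h3.symm
    simpa [ENNReal.smul_def] using this
  rw [this, one_smul]

theorem norm_stabAct (ρ : orthStab ω) (u : Perp ω) : ‖stabAct ρ u‖ = ‖u‖ :=
  ContinuousLinearMap.norm_map_of_mem_unitary (ρ : OrthGroup n).2 (u : Eu n)

theorem stabAct_mul (ρ τ : orthStab ω) (u : Perp ω) :
    stabAct (ρ * τ) u = stabAct ρ (stabAct τ u) := rfl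

theorem stabAct_one (u : Perp ω) : stabAct (1 : orthStab ω) u = u := rfl

theorem continuous_stabAct : Continuous fun p : orthStab ω × Perp ω => stabAct p.1 p.2 := by
  unfold stabAct
  refine Continuous.subtype_mk ?_ _
  have h1 : Continuous fun p : orthStab ω × Perp ω =>
      (((p.1 : OrthGroup n) : Eu n →L[ℝ] Eu n), ((p.2 : Perp ω) : Eu n)) := by fun_prop
  exact isBoundedBilinearMap_apply.continuous.comp h1

/-- An element of the stationary subgroup of `ω`, as a linear isometry of `Perp ω`. -/
noncomputable def stabIsometry (ρ : orthStab ω) : Perp ω ≃ₗᵢ[ℝ] Perp ω where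
  toFun := stabAct ρ
  invFun := stabAct ρ⁻¹
  map_add' x y := Subtype.ext (map_add ((ρ : OrthGroup n) : Eu n →L[ℝ] Eu n) (x : Eu n) y)
  map_smul' c x := Subtype.ext (map_smul ((ρ : OrthGroup n) : Eu n →L[ℝ] Eu n) c (x : Eu n))
  left_inv x := by rw [← stabAct_mul, inv_mul_cancel, stabAct_one]
  right_inv x := by rw [← stabAct_mul, mul_inv_cancel, stabAct_one]
  norm_map' := norm_stabAct ρ

/-- The action of the stationary subgroup of `ω` on the unit vectors orthogonal to `ω`. -/
noncomputable def stabSphere (ρ : orthStab ω) (θ : SubSph ω) : SubSph ω := sphereMap (stabIsometry ρ) θ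

theorem continuous_stabSphere :
    Continuous fun p : orthStab ω × SubSph ω => stabSphere p.1 p.2 :=
  Continuous.subtype_mk (continuous_stabAct.comp
    (f := fun p : orthStab ω × SubSph ω => (p.1, (p.2 : Perp ω))) (by fun_prop)) _

/-- The reflection that exchanges `x` and `y` fixes the hyperplane orthogonal to `x - y`, which
contains `ω` because `x` and `y` are orthogonal to `ω`. -/
theorem exists_stabSphere_eq (θ η : SubSph ω) : ∃ ρ : orthStab ω, stabSphere ρ θ = η := by
  set x : Eu n := ((θ : Perp ω) : Eu n)
  set y : Eu n := ((η : Perp ω) : Eu n)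
  have hx : ‖x‖ = 1 := norm_eq_of_mem_sphere θ
  have hy : ‖y‖ = 1 := norm_eq_of_mem_sphere η
  set R : Eu n ≃ₗᵢ[ℝ] Eu n := (ℝ ∙ (x - y))ᗮ.reflection with hR
  have hRω : R (ω : Eu n) = ω := by
    rw [hR, Submodule.reflection_eq_self_iff, Submodule.mem_orthogonal_singleton_iff_inner_left,
      inner_sub_right, Submodule.mem_orthogonal_singleton_iff_inner_right.1 (θ : Perp ω).2,
      Submodule.mem_orthogonal_singleton_iff_inner_right.1 (η : Perp ω).2, sub_zero]
  have hu : (R.toContinuousLinearEquiv : Eu n →L[ℝ] Eu n) ∈ unitary (Eu n →L[ℝ] Eu n) :=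
    (Unitary.linearIsometryEquiv.symm R).2
  refine ⟨⟨⟨_, hu⟩, hRω⟩, Subtype.ext (Subtype.ext ?_)⟩
  exact Submodule.reflection_sub (hx.trans hy.symm)

theorem finrank_perp {k : ℕ} (hn : n = k + 3) (ω : Sph n) : finrank ℝ (Perp ω) = k + 2 := by
  have : Fact (finrank ℝ (Eu n) = (k + 2) + 1) := ⟨by rw [finrank_euclideanSpace_fin, hn]⟩
  refine Submodule.finrank_orthogonal_span_singleton ?_
  have := norm_eq_of_mem_sphere ω
  intro h0
  rw [h0, norm_zero] at this
  exact zero_ne_one this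

/-- The point `v` guarantees a nonempty sphere; an empty one would have total mass 0. -/
theorem isProbabilityMeasure_subSphMeasure (v : SubSph ω) :
    IsProbabilityMeasure (subSphMeasure ω) := by
  have : Nontrivial (Perp ω) := ⟨v, 0, ne_of_apply_ne norm (by simp)⟩
  refine ⟨?_⟩
  rw [subSphMeasure, Measure.smul_apply, smul_eq_mul, ENNReal.inv_mul_cancel]
  · exact Measure.measure_univ_ne_zero.2 (Measure.toSphere_ne_zero _)
  · exact measure_ne_top _ _

theorem measurePreserving_stabSphere_left (ρ : orthStab ω) :
    MeasurePreserving (stabSphere ρ) (subSphMeasure ω) (subSphMeasure ω) :=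
  (measurePreserving_sphereMap (stabIsometry ρ)).smul_measure _

/-- The orbit map of a unit vector sends the Haar measure to the surface measure. -/
theorem measurePreserving_stabSphere (v : SubSph ω) :
    MeasurePreserving (fun ρ => stabSphere ρ v) (orthStabHaar ω) (subSphMeasure ω) := by
  have := isProbabilityMeasure_subSphMeasure v
  have hc : Measurable fun p : orthStab ω × SubSph ω => stabSphere p.1 p.2 :=
    continuous_stabSphere.measurable
  have hv : Measurable fun ρ : orthStab ω => stabSphere ρ v :=
    hc.comp (measurable_id.prodMk measurable_const)
  refine ⟨hv, Measure.ext fun s hs => ?_⟩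
  have hind : Measurable fun p : orthStab ω × SubSph ω =>
      s.indicator (1 : SubSph ω → ℝ≥0∞) (stabSphere p.1 p.2) :=
    (measurable_one.indicator hs).comp hc
  -- The mass of `{(ρ, θ) | ρθ ∈ s}` is computed in both orders. Integrating `θ` first uses
  -- invariance of the surface measure; integrating `ρ` first uses `θ = τv` and right invariance of
  -- the Haar measure.
  have h1 : ∫⁻ ρ, ∫⁻ θ, s.indicator (1 : SubSph ω → ℝ≥0∞) (stabSphere ρ θ) ∂subSphMeasure ω
      ∂orthStabHaar ω = subSphMeasure ω s := by
    have : ∀ ρ : orthStab ω, ∫⁻ θ, s.indicator (1 : SubSph ω → ℝ≥0∞) (stabSphere ρ θ)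
        ∂subSphMeasure ω = subSphMeasure ω s := fun ρ => by
      rw [(measurePreserving_stabSphere_left ρ).lintegral_comp (measurable_one.indicator hs),
        lintegral_indicator_one hs]
    simp [this]
  have h2 : ∫⁻ θ, ∫⁻ ρ, s.indicator (1 : SubSph ω → ℝ≥0∞) (stabSphere ρ θ) ∂orthStabHaar ω
      ∂subSphMeasure ω = (orthStabHaar ω).map (fun ρ => stabSphere ρ v) s := by
    have : ∀ θ : SubSph ω, ∫⁻ ρ, s.indicator (1 : SubSph ω → ℝ≥0∞) (stabSphere ρ θ)
        ∂orthStabHaar ω = (orthStabHaar ω).map (fun ρ => stabSphere ρ v) s := fun θ => by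
      obtain ⟨τ, rfl⟩ := exists_stabSphere_eq v θ
      rw [← lintegral_indicator_one hs, lintegral_map (measurable_one.indicator hs) hv]
      exact lintegral_mul_right_eq_self
        (fun ρ => s.indicator (1 : SubSph ω → ℝ≥0∞) (stabSphere ρ v)) τ
    simp [this]
  rw [← h1, ← h2]
  exact lintegral_lintegral_swap (f := fun θ ρ =>
    s.indicator (1 : SubSph ω → ℝ≥0∞) (stabSphere ρ θ)) (hind.comp measurable_swap).aemeasurable

end LineHyperplane

/-! ### Independence of direction and height, and the mean value formula. -/

namespace LineHyperplane

variable {n : ℕ} {ω : Sph n}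

theorem sphereArea_pos (m : ℕ) : 0 < sphereArea m := by
  have hpi := Real.pi_pos
  have := Real.Gamma_pos_of_pos (show (0 : ℝ) < ((m : ℝ) + 1) / 2 by positivity)
  unfold sphereArea
  positivity

/-- The density on `(0, r)` of the law of `r * |⟪θ, η⟫|`, where `η` is uniformly distributed over
the unit sphere of dimension `k + 1`. -/
noncomputable def heightDensity (k : ℕ) (r t : ℝ) : ℝ :=
  2 * sphereArea k / sphereArea (k + 1) / r ^ k * (r ^ 2 - t ^ 2) ^ (((k : ℝ) - 1) / 2)

theorem measurable_heightDensity (k : ℕ) (r : ℝ) : Measurable (heightDensity k r) := by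
  unfold heightDensity; fun_prop

theorem heightDensity_nonneg (k : ℕ) {r : ℝ} {t : ℝ} (ht : t ∈ Ioo 0 r) :
    0 ≤ heightDensity k r t := by
  have h1 := sphereArea_pos k
  have h2 := sphereArea_pos (k + 1)
  have hr : 0 < r := ht.1.trans ht.2
  have h3 : 0 ≤ r ^ 2 - t ^ 2 := by nlinarith [ht.1, ht.2]
  have h4 := Real.rpow_nonneg h3 (((k : ℝ) - 1) / 2)
  unfold heightDensity
  positivity

/-- The law of `r * |⟪θ, η⟫|` for a unit vector `η` uniformly distributed in `Perp ω`. -/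
noncomputable def heightMeasure (k : ℕ) (r : ℝ) : Measure ℝ :=
  (volume.restrict (Ioo 0 r)).withDensity fun t => ENNReal.ofReal (heightDensity k r t)

theorem map_abs_inner_subSphMeasure {k : ℕ} (hn : n = k + 3) {r : ℝ} (hr : 0 < r)
    (θ : SubSph ω) :
    (subSphMeasure ω).map (fun η : SubSph ω => r * |⟪(θ : Perp ω), (η : Perp ω)⟫_ℝ|) =
      heightMeasure k r := by
  have hθ : ‖(θ : Perp ω)‖ = 1 := norm_eq_of_mem_sphere θ
  have hθ0 : (θ : Perp ω) ≠ 0 := by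
    intro h0; rw [h0, norm_zero] at hθ; exact zero_ne_one hθ
  have hE := finrank_perp hn ω
  have hF : finrank ℝ (ℝ ∙ (θ : Perp ω))ᗮ = k + 1 := by
    have : Fact (finrank ℝ (Perp ω) = (k + 1) + 1) := ⟨hE⟩
    exact Submodule.finrank_orthogonal_span_singleton hθ0
  have hm : Measurable fun η : SubSph ω => r * |⟪(θ : Perp ω), (η : Perp ω)⟫_ℝ| := by fun_prop
  have h1 := sphereArea_pos k
  have h2 := sphereArea_pos (k + 1)
  refine Measure.ext_of_lintegral _ fun h hh => ?_
  rw [lintegral_map hh hm, heightMeasure, lintegral_withDensity_eq_lintegral_mul _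
    (measurable_heightDensity k r).ennreal_ofReal hh, subSphMeasure, lintegral_smul_measure,
    lintegral_toSphere_abs_inner hE hθ hr hh, toSphere_univ_eq_sphereArea hE,
    toSphere_univ_eq_sphereArea hF, smul_eq_mul, ← ENNReal.ofReal_inv_of_pos h2,
    show (2 : ℝ≥0∞) = ENNReal.ofReal 2 by simp, ← mul_assoc, ← mul_assoc,
    ← ENNReal.ofReal_mul (by positivity), ← ENNReal.ofReal_mul (by positivity),
    ← lintegral_const_mul _ (by fun_prop)]
  refine lintegral_congr fun t => ?_
  rw [Pi.mul_apply, ← mul_assoc, ← ENNReal.ofReal_mul (by positivity), heightDensity]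
  congr 2
  field_simp

/-- The direction of a random hyperplane through a random line of the cluster is independent of
its distance to the origin. -/
theorem measurePreserving_direction_height {k : ℕ} (hn : n = k + 3) {r : ℝ} (hr : 0 < r)
    (v : SubSph ω) :
    MeasurePreserving
      (fun p : orthStab ω × SubSph ω =>
        (r * |⟪(p.2 : Perp ω), stabAct p.1 (v : Perp ω)⟫_ℝ|, p.2))
      ((orthStabHaar ω).prod (subSphMeasure ω)) ((heightMeasure k r).prod (subSphMeasure ω)) := by
  have := isProbabilityMeasure_subSphMeasure v
  have hsf : SFinite (heightMeasure k r) := by unfold heightMeasure; infer_instance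
  -- Every fibre over `θ` has the same image law, so the skew product has a product measure as its
  -- image.
  have h1 : MeasurePreserving
      (fun p : SubSph ω × SubSph ω => (p.1, r * |⟪(p.1 : Perp ω), (p.2 : Perp ω)⟫_ℝ|))
      ((subSphMeasure ω).prod (subSphMeasure ω)) ((subSphMeasure ω).prod (heightMeasure k r)) :=
    (MeasurePreserving.id _).skew_product
      (g := fun θ η : SubSph ω => r * |⟪(θ : Perp ω), (η : Perp ω)⟫_ℝ|)
      (by unfold Function.uncurry; fun_prop)
      (ae_of_all _ fun θ => map_abs_inner_subSphMeasure hn hr θ)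
  have h2 : MeasurePreserving (fun p : orthStab ω × SubSph ω => (p.2, stabSphere p.1 v))
      ((orthStabHaar ω).prod (subSphMeasure ω)) ((subSphMeasure ω).prod (subSphMeasure ω)) :=
    Measure.measurePreserving_swap.comp
      ((measurePreserving_stabSphere v).prod (MeasurePreserving.id _))
  exact Measure.measurePreserving_swap.comp (h1.comp h2)

theorem integrable_prod_heightMeasure_iff {k : ℕ} {r : ℝ} {μ : Measure (SubSph ω)} [SFinite μ]
    {F : ℝ × SubSph ω → ℂ} :
    Integrable F ((heightMeasure k r).prod μ) ↔
      Integrable (fun p => (heightDensity k r p.1 : ℂ) * F p)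
        ((volume.restrict (Ioo 0 r)).prod μ) := by
  have hm : Measurable fun p : ℝ × SubSph ω => ENNReal.ofReal (heightDensity k r p.1) :=
    ((measurable_heightDensity k r).comp measurable_fst).ennreal_ofReal
  rw [heightMeasure, prod_withDensity_left (measurable_heightDensity k r).ennreal_ofReal,
    integrable_withDensity_iff_integrable_smul' hm (ae_of_all _ fun _ => ENNReal.ofReal_lt_top)]
  refine integrable_congr ?_
  -- Outside `(0, r)` the real power may be negative and `ENNReal.ofReal` would truncate it, so the
  -- restriction to `(0, r)` is needed.
  have h : ∀ᵐ p ∂((volume.restrict (Ioo 0 r)).prod μ), p.1 ∈ Ioo 0 r :=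
    Measure.quasiMeasurePreserving_fst.ae (ae_restrict_mem measurableSet_Ioo)
  filter_upwards [h] with p hp
  rw [ENNReal.toReal_ofReal (heightDensity_nonneg k hp), Complex.real_smul]

theorem integral_heightMeasure {k : ℕ} {r : ℝ} (f : ℝ → ℂ) :
    ∫ t, f t ∂(heightMeasure k r) = ∫ t in Ioo 0 r, (heightDensity k r t : ℂ) * f t := by
  rw [heightMeasure, integral_withDensity_eq_integral_toReal_smul
    (measurable_heightDensity k r).ennreal_ofReal (ae_of_all _ fun _ => ENNReal.ofReal_lt_top)]
  refine setIntegral_congr_fun measurableSet_Ioo fun t ht => ?_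
  simp only [ENNReal.toReal_ofReal (heightDensity_nonneg k ht), Complex.real_smul]

theorem IsEvenHyp.apply_abs {φ : Sph n → ℝ → ℂ} (hφ : IsEvenHyp φ) (θ : Sph n) (t : ℝ) :
    φ θ |t| = φ θ t := by
  rcases abs_choice t with h | h
  · rw [h]
  · rw [h, ← (hφ θ t).1]

end LineHyperplane

theorem lemma4p1 (n : ℕ) (hn : 3 ≤ n) (φ : Sph n → ℝ → ℂ) (hφ : IsEvenHyp φ)
    (ω : Sph n) (r : ℝ) (hr : 0 < r)
    (hint : Integrable
      (fun p : ℝ × SubSph ω =>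
        (((r ^ 2 - p.1 ^ 2) ^ (((n : ℝ) - 4) / 2) : ℝ) : ℂ) * φ p.2.toSph p.1)
      ((volume.restrict (Set.Ioo 0 r)).prod (subSphMeasure ω)))
    (v : SubSph ω) :
    (∀ᵐ ρ ∂(orthStabHaar ω), Integrable
      (fun θ : SubSph ω => φ θ.toSph ⟪(θ : Perp ω), r • stabAct ρ (v : Perp ω)⟫_ℝ)
      (subSphMeasure ω)) ∧
    Integrable (fun ρ : orthStab ω => dualRadon φ ⟨ω, r • stabAct ρ (v : Perp ω)⟩)
      (orthStabHaar ω) ∧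
    clusterMean ω v (dualRadon φ) r =
      ((2 * sphereArea (n - 3) / sphereArea (n - 2) / r ^ (n - 3) : ℝ) : ℂ) *
        ∫ t in Set.Ioo 0 r, (((r ^ 2 - t ^ 2) ^ (((n : ℝ) - 4) / 2) : ℝ) : ℂ) *
          ∫ θ : SubSph ω, φ θ.toSph t ∂(subSphMeasure ω) := by
  obtain ⟨k, hk⟩ : ∃ k, n = k + 3 := ⟨n - 3, by omega⟩
  have := isProbabilityMeasure_subSphMeasure v
  have hsf : SFinite (heightMeasure k r) := by unfold heightMeasure; infer_instance
  have hexp : ((n : ℝ) - 4) / 2 = ((k : ℝ) - 1) / 2 := by rw [hk]; push_cast; ring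
  rw [hexp] at hint ⊢
  rw [show n - 3 = k by omega, show n - 2 = k + 1 by omega]
  set F : ℝ × SubSph ω → ℂ := fun p => φ p.2.toSph p.1 with hF
  have hFint : Integrable F ((heightMeasure k r).prod (subSphMeasure ω)) := by
    rw [integrable_prod_heightMeasure_iff]
    refine (hint.const_mul
      ((2 * sphereArea k / sphereArea (k + 1) / r ^ k : ℝ) : ℂ)).congr (ae_of_all _ fun p => ?_)
    simp only [heightDensity, hF, Complex.ofReal_mul]
    ring
  have hT := measurePreserving_direction_height hk hr v
  -- Evenness in `t` enters here: the signed distance is replaced by the height.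
  have heq : ∀ (ρ : orthStab ω) (θ : SubSph ω),
      φ θ.toSph ⟪(θ : Perp ω), r • stabAct ρ (v : Perp ω)⟫_ℝ =
        F (r * |⟪(θ : Perp ω), stabAct ρ (v : Perp ω)⟫_ℝ|, θ) := fun ρ θ => by
    rw [← hφ.apply_abs, inner_smul_right, abs_mul, abs_of_pos hr]
  have hG : Integrable (fun p : orthStab ω × SubSph ω =>
      φ p.2.toSph ⟪(p.2 : Perp ω), r • stabAct p.1 (v : Perp ω)⟫_ℝ)
      ((orthStabHaar ω).prod (subSphMeasure ω)) := by
    simp only [heq]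
    exact hT.integrable_comp_of_integrable hFint
  refine ⟨hG.prod_right_ae, hG.integral_prod_left, ?_⟩
  calc
    clusterMean ω v (dualRadon φ) r
      = ∫ p : orthStab ω × SubSph ω,
          φ p.2.toSph ⟪(p.2 : Perp ω), r • stabAct p.1 (v : Perp ω)⟫_ℝ
          ∂((orthStabHaar ω).prod (subSphMeasure ω)) := (integral_prod _ hG).symm
    _ = ∫ p, F p ∂((heightMeasure k r).prod (subSphMeasure ω)) := by
      rw [← hT.map_eq, integral_map hT.measurable.aemeasurable]
      · simp only [heq]
      · rw [hT.map_eq]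
        exact hFint.aestronglyMeasurable
    _ = _ := by
      rw [integral_prod _ hFint, integral_heightMeasure, ← integral_const_mul]
      refine integral_congr_ae (ae_of_all _ fun t => ?_)
      simp only [heightDensity, hF, Complex.ofReal_mul]
      ring
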